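/- Let $H$ be a complex Hilbert space and let $A\in B(H)$ be a non-zero positive (semidefinite) operator. Put $\langle x,y\rangle_A=\langle Ax,y\rangle$ and $\|x\|_A=\langle x,x\rangle_A^{1/2}$. Write $R(S)$ for the range of $S\in B(H)$ and let $$B_A(H)=\{T\in B(H): R(T^*A)\subseteq R(A)\},\qquad B_{A^{1/2}}(H)=\{T\in B(H): R(T^*A^{1/2})\subseteq R(A^{1/2})\}.$$ For $T\in B_A(H)$ let $T^\sharp\in B(H)$ be the unique operator with $T^*A=AT^\sharp$ and $R(T^\sharp)\subseteq\overline{R(A)}$. The operator $T\in B_A(H)$ is called $A$-hyponormal if $T^\sharp T-TT^\sharp\ge_A 0$, that is, if $A(T^\sharp T-TT^\sharp)$ is a positive operator. The $A$-numerical range of $T$ is $$W_A(T)=\{\langle Tx,x\rangle_A : x\in H,\ \|x\|_A=1\}.$$ A non-zero operator $T\in B_{A^{1/2}}(H)$ is $A$-invertible in $B_{A^{1/2}}(H)$ if there is a non-zero $S\in B_{A^{1/2}}(H)$ with $ATS=AST=A$. The $A$-spectrum $\sigma_A(T)$ is the set of all $\lambda\in\mathbb C$ such that $\lambda-T$ is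 not $A$-invertible in $B_{A^{1/2}}(H)$. Let $T\in B_A(H)$ be $A$-hyponormal and suppose that $TA=AT$. Then $$\overline{W_A(T)}=\mathrm{conv}(\sigma_A(T)),$$ where the bar denotes the closure in $\mathbb C$ and $\mathrm{conv}$ the convex hull. -/

import Mathlib

/-! Operators on a complex semi-Hilbertian space: `H` is a complex Hilbert space and `A` is a
positive bounded operator on `H`, which induces the semi-inner product `⟨A x, y⟩`.
Mathlib's `inner ℂ x y` is conjugate-linear in the first variable, so that the form
`⟨x, y⟩`, linear in `x`, is `inner ℂ y x`. -/

namespace SemiHilbert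

variable {H : Type*} [NormedAddCommGroup H] [InnerProductSpace ℂ H] [CompleteSpace H]

/-- The sesquilinear form `⟨x, y⟩_A = ⟨A x, y⟩`, linear in `x`. -/
noncomputable def innerA (A : H →L[ℂ] H) (x y : H) : ℂ := inner ℂ y (A x)

/-- The seminorm `‖x‖_A = ⟨x, x⟩_A ^ (1/2)`. -/
noncomputable def normA (A : H →L[ℂ] H) (x : H) : ℝ := Real.sqrt (innerA A x x).re

/-- `B_A(H)`: the operators `T` with `R(T* A) ⊆ R(A)`. -/
def BA (A : H →L[ℂ] H) : Set (H →L[ℂ] H) :=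
  {T | Set.range (ContinuousLinearMap.adjoint T ∘L A) ⊆ Set.range A}

/-- `B_{A^{1/2}}(H)`: the operators `T` with `R(T* A^{1/2}) ⊆ R(A^{1/2})`. -/
noncomputable def BAhalf (A : H →L[ℂ] H) : Set (H →L[ℂ] H) :=
  {T | Set.range (ContinuousLinearMap.adjoint T ∘L (CFC.sqrt A : H →L[ℂ] H)) ⊆
    Set.range (CFC.sqrt A : H →L[ℂ] H)}

/-- `V` is a reduced solution of `T* A = A X`: it solves the equation and its range lies in the
closure of the range of `A`. -/
def IsReducedAdjoint (A T V : H →L[ℂ] H) : Prop :=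
  ContinuousLinearMap.adjoint T ∘L A = A ∘L V ∧ Set.range V ⊆ closure (Set.range A)

/-- For `A` positive and `T ∈ B_A(H)`, the reduced solution of `T* A = A X` exists and is
unique. -/
theorem existsUnique_isReducedAdjoint {A : H →L[ℂ] H} (hA : A.IsPositive) {T : H →L[ℂ] H}
    (hT : T ∈ BA A) : ∃! V : H →L[ℂ] H, IsReducedAdjoint A T V := by
  have hsym : ∀ x y : H, inner ℂ (A x) y = inner ℂ x (A y) := hA.isSymmetric
  have hcl : closure (Set.range A) = (A.ker.orthogonal : Set H) := by
    have h1 : A.ker = A.range.orthogonal := by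
      ext x
      rw [Submodule.mem_orthogonal]
      constructor
      · rintro hx _ ⟨y, rfl⟩
        have hx' : A x = 0 := hx
        simp [hsym, hx']
      · intro h
        have := h (A (A x)) ⟨A x, rfl⟩
        rw [hsym] at this
        exact inner_self_eq_zero.mp this
    rw [h1, Submodule.orthogonal_orthogonal_eq_closure, Submodule.topologicalClosure_coe]
    rfl
  have hinj : ∀ y ∈ A.ker.orthogonal, A y = 0 → y = 0 := by
    intro y hy h0
    exact inner_self_eq_zero.mp ((Submodule.mem_orthogonal _ _).mp hy y h0)
  have hex : ∀ x, ∃ y ∈ A.ker.orthogonal, A y = ContinuousLinearMap.adjoint T (A x) := by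
    intro x
    obtain ⟨z, hz⟩ := hT ⟨x, rfl⟩
    have : A.ker.HasOrthogonalProjection :=
      haveI : CompleteSpace A.ker := A.isClosed_ker.completeSpace_coe
      inferInstance
    obtain ⟨k, hk, w, hw, rfl⟩ := Submodule.exists_add_mem_mem_orthogonal (K := A.ker) z
    have hk' : A k = 0 := hk
    refine ⟨w, hw, ?_⟩
    rw [map_add, hk', zero_add] at hz
    exact hz
  choose f hf hAf using hex
  have huniq : ∀ x y, y ∈ A.ker.orthogonal → A y = ContinuousLinearMap.adjoint T (A x) →
      y = f x := by
    intro x y hy hxy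
    refine sub_eq_zero.mp (hinj _ (Submodule.sub_mem _ hy (hf x)) ?_)
    rw [map_sub, hxy, hAf, sub_self]
  let F : H →ₗ[ℂ] H :=
    { toFun := f
      map_add' := fun x y => (huniq _ _ (Submodule.add_mem _ (hf x) (hf y)) (by
        simp [hAf])).symm
      map_smul' := fun c x => (huniq _ _ (Submodule.smul_mem _ c (hf x)) (by
        simp [hAf])).symm }
  have hF : IsClosed (F.graph : Set (H × H)) := by
    have : (F.graph : Set (H × H)) = {p | p.2 ∈ A.ker.orthogonal} ∩
        {p | A p.2 = ContinuousLinearMap.adjoint T (A p.1)} := by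
      ext ⟨x, y⟩
      simp only [SetLike.mem_coe, LinearMap.mem_graph_iff, Set.mem_inter_iff, Set.mem_ofPred_eq]
      constructor
      · rintro rfl
        exact ⟨hf x, hAf x⟩
      · rintro ⟨h1, h2⟩
        exact huniq x y h1 h2
    rw [this]
    refine IsClosed.inter ?_ (isClosed_eq (by fun_prop) (by fun_prop))
    exact (Submodule.isClosed_orthogonal A.ker).preimage continuous_snd
  refine ⟨⟨F, F.continuous_of_isClosed_graph hF⟩, ⟨?_, ?_⟩, ?_⟩
  · ext x
    exact (hAf x).symm
  · rw [hcl]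
    rintro _ ⟨x, rfl⟩
    exact hf x
  · rintro V ⟨h1, h2⟩
    ext x
    refine huniq x (V x) ?_ (DFunLike.congr_fun h1 x).symm
    have := h2 ⟨x, rfl⟩
    rw [hcl] at this
    exact this

open Classical in
/-- The operator `T^♯`: the reduced solution of `T* A = A X` (and `0` if there is none, which
does not happen for `A` positive and `T ∈ B_A(H)`). -/
noncomputable def sharp (A T : H →L[ℂ] H) : H →L[ℂ] H :=
  if h : ∃ V : H →L[ℂ] H, IsReducedAdjoint A T V then h.choose else 0

theorem isReducedAdjoint_sharp {A : H →L[ℂ] H} (hA : A.IsPositive) {T : H →L[ℂ] H}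
    (hT : T ∈ BA A) : IsReducedAdjoint A T (sharp A T) := by
  have h := (existsUnique_isReducedAdjoint hA hT).exists
  rw [sharp, dif_pos h]
  exact h.choose_spec

/-- `S ≥_A 0`, that is, `A S` is a positive operator. -/
def IsAPositive (A S : H →L[ℂ] H) : Prop := (A ∘L S).IsPositive

/-- `T` is `A`-hyponormal: `T^♯ T - T T^♯ ≥_A 0` (meant for `T ∈ B_A(H)`). -/
def IsAHyponormal (A T : H →L[ℂ] H) : Prop :=
  IsAPositive A (sharp A T * T - T * sharp A T)

/-- The `A`-numerical range `W_A(T) = {⟨T x, x⟩_A : ‖x‖_A = 1}`. -/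
def numericalRangeA (A T : H →L[ℂ] H) : Set ℂ :=
  {z | ∃ x : H, normA A x = 1 ∧ innerA A (T x) x = z}

/-- `T` is `A`-invertible in `B_{A^{1/2}}(H)`. -/
def IsAInvertible (A T : H →L[ℂ] H) : Prop :=
  T ∈ BAhalf A ∧ T ≠ 0 ∧ ∃ S ∈ BAhalf A, S ≠ 0 ∧ A * T * S = A ∧ A * S * T = A

/-- The `A`-resolvent set of `T`. -/
def resolventSetA (A T : H →L[ℂ] H) : Set ℂ :=
  {z | IsAInvertible A (z • (1 : H →L[ℂ] H) - T)}

/-- The `A`-spectrum `σ_A(T)`, the complement of the `A`-resolvent set. -/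
def spectrumA (A T : H →L[ℂ] H) : Set ℂ := (resolventSetA A T)ᶜ

end SemiHilbert

/-! Put $B=A^{1/2}$. Since $T$ commutes with $A$, it commutes with $B$, so $\langle
Tx,x\rangle_A=\langle TBx,Bx\rangle$ and $\|x\|_A=\|Bx\|$. Everything therefore passes to the
restriction $T_0$ of $T$ to $K=\overline{R(B)}$: the closures of $W_A(T)$ and $W(T_0)$ agree by
density, $A$-hyponormality makes $T_0$ hyponormal, and $\sigma_A(T)=\sigma(T_0)$.

What remains is the classical theorem for hyponormal operators on a nonzero space. The spectrum lies
in $\overline{W(T_0)}$, which is convex by Toeplitz–Hausdorff. Conversely, each translate $T_0-a$ is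
hyponormal, so its norm is its spectral radius, and every closed disc containing $\sigma(T_0)$
contains $W(T_0)$. The compact set $\mathrm{conv}\,\sigma(T_0)$ is the intersection of such discs.
-/

/-- The convex hull of a compact set in a finite-dimensional space is compact. -/
theorem IsCompact.convexHull_of_finiteDimensional {E : Type*} [NormedAddCommGroup E]
    [NormedSpace ℝ E] [FiniteDimensional ℝ E] {s : Set E} (hs : IsCompact s) :
    IsCompact (convexHull ℝ s) := by
  -- Carathéodory: at most dim + 1 points suffice, so the hull is a finite union of continuous
  -- images of compact sets.
  have key : convexHull ℝ s = ⋃ k ∈ Finset.range (Module.finrank ℝ E + 2),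
      (fun p : (Fin k → ℝ) × (Fin k → E) => ∑ i, p.1 i • p.2 i) ''
        (stdSimplex ℝ (Fin k) ×ˢ Set.univ.pi fun _ => s) := by
    ext x
    simp only [Set.mem_iUnion, Set.mem_image, exists_prop, Finset.mem_range]
    constructor
    · intro hx
      obtain ⟨ι, _, z, w, hz, hind, hw, hw1, hx⟩ := eq_pos_convex_span_of_mem_convexHull hx
      have hcard : Fintype.card ι ≤ Module.finrank ℝ E + 1 :=
        hind.card_le_finrank_succ.trans (by gcongr; exact Submodule.finrank_le _)
      let e := (Fintype.equivFin ι).symm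
      refine ⟨Fintype.card ι, by omega, (w ∘ e, z ∘ e), ⟨⟨fun i => (hw _).le, ?_⟩,
        fun i _ => hz ⟨_, rfl⟩⟩, ?_⟩
      · rw [← hw1]
        exact e.sum_comp w
      · rw [← hx]
        exact e.sum_comp fun i => w i • z i
    · rintro ⟨k, -, ⟨w, z⟩, ⟨hw, hz⟩, rfl⟩
      exact (convex_convexHull ℝ s).sum_mem (fun i _ => hw.1 i) hw.2
        fun i _ => subset_convexHull ℝ s (hz i trivial)
  rw [key]
  refine (Finset.range _).isCompact_biUnion fun k _ => ?_
  exact ((isCompact_stdSimplex ℝ (Fin k)).prod (isCompact_univ_pi fun _ => hs)).image (by fun_prop)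

/-! ### Numerical range: convexity and the spectrum -/

namespace ContinuousLinearMap

variable {E : Type*} [NormedAddCommGroup E] [InnerProductSpace ℂ E]

/-- The numerical range `{⟨T x, x⟩ : ‖x‖ = 1}` of an operator. -/
def numericalRange (T : E →L[ℂ] E) : Set ℂ := {z | ∃ x : E, ‖x‖ = 1 ∧ inner ℂ x (T x) = z}

theorem mem_numericalRange_of_ne_zero {T : E →L[ℂ] E} {x : E} {z : ℂ} (hx : x ≠ 0)
    (h : inner ℂ x (T x) = z * (‖x‖ : ℂ) ^ 2) : z ∈ numericalRange T := by
  have hx' : (‖x‖ : ℂ) ≠ 0 := by simpa using hx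
  refine ⟨(‖x‖ : ℂ)⁻¹ • x, ?_, ?_⟩
  · rw [norm_smul, norm_inv, Complex.norm_real, norm_norm, inv_mul_cancel₀ (norm_ne_zero_iff.mpr hx)]
  · rw [map_smul, inner_smul_left, inner_smul_right, h, map_inv₀, Complex.conj_ofReal]
    field_simp

theorem exists_norm_eq_one_im_mul_eq_zero (d : ℂ) : ∃ ω : ℂ, ‖ω‖ = 1 ∧ (ω * d).im = 0 := by
  by_cases hd : d = 0
  · exact ⟨1, by simp [hd]⟩
  · have hd' : (‖d‖ : ℂ) ≠ 0 := by simpa using hd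
    refine ⟨(starRingEnd ℂ) d / ‖d‖, by simp [hd], ?_⟩
    have : (starRingEnd ℂ) d / ‖d‖ * d = ((‖d‖ : ℝ) : ℂ) := by
      rw [div_mul_eq_mul_div, Complex.conj_mul']
      field_simp
    rw [this, Complex.ofReal_im]

/-- A change of phase in one of the two unit vectors makes the form real along the segment joining
them; the intermediate value theorem then gives a vector whose Rayleigh quotient is `t`. -/
theorem ofReal_mem_numericalRange_of_zero_of_one {T : E →L[ℂ] E} (h0 : 0 ∈ numericalRange T)
    (h1 : 1 ∈ numericalRange T) {t : ℝ} (ht : t ∈ Set.Icc (0 : ℝ) 1) :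
    (t : ℂ) ∈ numericalRange T := by
  obtain ⟨x, hx, hTx⟩ := h0
  obtain ⟨y', hy', hTy'⟩ := h1
  -- With `y = ω • y'`, the sum of the cross terms has the same imaginary part as `ω` times this
  -- difference.
  obtain ⟨ω, hω, him⟩ := exists_norm_eq_one_im_mul_eq_zero
    (inner ℂ x (T y') - (starRingEnd ℂ) (inner ℂ y' (T x)))
  obtain ⟨y, hy⟩ : ∃ y, y = ω • y' := ⟨_, rfl⟩
  have hyn : ‖y‖ = 1 := by rw [hy, norm_smul, hω, hy', one_mul]
  have hTy : inner ℂ y (T y) = 1 := by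
    rw [hy, map_smul, inner_smul_left, inner_smul_right, hTy', mul_one, Complex.conj_mul', hω]
    simp
  have hcross : (inner ℂ x (T y) + inner ℂ y (T x)).im = 0 := by
    rw [hy, map_smul, inner_smul_left, inner_smul_right]
    simp only [Complex.mul_im, Complex.sub_re, Complex.sub_im, Complex.conj_re, Complex.conj_im,
      Complex.add_im] at him ⊢
    linarith
  let u : ℝ → E := fun s => ((1 - s : ℝ) : ℂ) • x + (s : ℂ) • y
  have hu : ∀ s, inner ℂ (u s) (T (u s)) =
      ((s * (1 - s) : ℝ) : ℂ) * (inner ℂ x (T y) + inner ℂ y (T x)) + ((s ^ 2 : ℝ) : ℂ) := by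
    intro s
    simp only [u, map_add, map_smul, inner_add_left, inner_add_right, inner_smul_left,
      inner_smul_right, hTx, hTy, Complex.conj_ofReal]
    push_cast
    ring
  have huim : ∀ s, (inner ℂ (u s) (T (u s))).im = 0 := by
    intro s
    rw [hu, Complex.add_im, Complex.im_ofReal_mul, hcross, Complex.ofReal_im]
    simp
  have hcont : Continuous fun s => (inner ℂ (u s) (T (u s))).re - t * ‖u s‖ ^ 2 := by
    have : Continuous u := by fun_prop
    fun_prop
  have h0 : (inner ℂ (u 0) (T (u 0))).re - t * ‖u 0‖ ^ 2 ≤ 0 := by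
    simpa [u, hTx, hx] using ht.1
  have h1 : 0 ≤ (inner ℂ (u 1) (T (u 1))).re - t * ‖u 1‖ ^ 2 := by
    simpa [u, hTy, hyn] using ht.2
  obtain ⟨s, -, hs⟩ := intermediate_value_Icc zero_le_one hcont.continuousOn ⟨h0, h1⟩
  have hs' : (inner ℂ (u s) (T (u s))).re = t * ‖u s‖ ^ 2 := sub_eq_zero.mp hs
  refine mem_numericalRange_of_ne_zero (x := u s) ?_ ?_
  -- If `u s = 0`, comparing the form at `(1 - s) • x` and at `-(s • y)` gives `0 = s ^ 2`, hence `x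
  -- = 0`.
  · intro hus
    have e1 : ((1 - s : ℝ) : ℂ) • x = -((s : ℂ) • y) := eq_neg_of_add_eq_zero_left hus
    have e2 := congrArg (fun v => inner ℂ v (T v)) e1
    simp only [map_smul, map_neg, inner_neg_left, inner_neg_right, inner_smul_left,
      inner_smul_right, hTx, hTy, Complex.conj_ofReal, mul_zero, mul_one] at e2
    have hs0 : s = 0 := by simpa using e2.symm
    simp only [hs0, sub_zero, Complex.ofReal_one, one_smul, Complex.ofReal_zero, zero_smul,
      neg_zero] at e1
    simp [e1] at hx
  · apply Complex.ext
    · rw [hs', ← Complex.ofReal_pow, ← Complex.ofReal_mul, Complex.ofReal_re]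
    · rw [huim, ← Complex.ofReal_pow, ← Complex.ofReal_mul, Complex.ofReal_im]

/-- The **Toeplitz–Hausdorff theorem**: the numerical range is convex. -/
theorem convex_numericalRange (T : E →L[ℂ] E) : Convex ℝ (numericalRange T) := by
  rw [convex_iff_segment_subset]
  intro a ha b hb z hz
  rw [segment_eq_image_lineMap] at hz
  obtain ⟨t, ht, rfl⟩ := hz
  rw [AffineMap.lineMap_apply_module', Complex.real_smul]
  by_cases hab : a = b
  · simpa [hab] using hb
  have hab' : b - a ≠ 0 := sub_ne_zero.mpr (Ne.symm hab)
  -- The affine change of `T` that moves `a` to 0 and `b` to 1.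
  have hform : ∀ x : E, ‖x‖ = 1 →
      inner ℂ x (((b - a)⁻¹ • (T - a • (1 : E →L[ℂ] E))) x) =
        (b - a)⁻¹ * (inner ℂ x (T x) - a) := by
    intro x hx
    simp [inner_self_eq_norm_sq_to_K, hx]
  obtain ⟨x, hx, hTx⟩ := ha
  obtain ⟨y, hy, hTy⟩ := hb
  obtain ⟨u, hu, hTu⟩ := ofReal_mem_numericalRange_of_zero_of_one
    (T := (b - a)⁻¹ • (T - a • (1 : E →L[ℂ] E)))
    ⟨x, hx, by rw [hform x hx, hTx, sub_self, mul_zero]⟩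
    ⟨y, hy, by rw [hform y hy, hTy, inv_mul_cancel₀ hab']⟩ ht
  refine ⟨u, hu, ?_⟩
  rw [hform u hu, inv_mul_eq_iff_eq_mul₀ hab'] at hTu
  linear_combination hTu

variable [CompleteSpace E]

/-- At distance at least ε from the numerical range, `|⟨(z - T)x, x⟩| ≥ ε‖x‖²`, and this coercivity
makes `z - T` invertible. -/
theorem spectrum_subset_closure_numericalRange (T : E →L[ℂ] E) :
    spectrum ℂ T ⊆ closure (numericalRange T) := by
  intro z hz
  by_contra hzc
  obtain ⟨ε, hε, hball⟩ := Metric.isOpen_iff.mp isClosed_closure.isOpen_compl z hzc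
  refine hz (isUnit_of_forall_le_norm_inner_map _ (c := ⟨ε, hε.le⟩) hε fun x => ?_)
  rcases eq_or_ne x 0 with rfl | hx
  · simp
  have hx' : (‖x‖ : ℂ) ≠ 0 := by simpa using hx
  have hmem : inner ℂ x (T x) / (‖x‖ : ℂ) ^ 2 ∈ numericalRange T :=
    mem_numericalRange_of_ne_zero hx (by field_simp)
  have hdist : ε ≤ ‖inner ℂ x (T x) / (‖x‖ : ℂ) ^ 2 - z‖ := by
    by_contra! h
    exact hball (by rwa [Metric.mem_ball, dist_eq_norm]) (subset_closure hmem)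
  have heq : ‖inner ℂ ((algebraMap ℂ (E →L[ℂ] E) z - T) x) x‖ =
      ‖x‖ ^ 2 * ‖inner ℂ x (T x) / (‖x‖ : ℂ) ^ 2 - z‖ := by
    have : inner ℂ x ((algebraMap ℂ (E →L[ℂ] E) z - T) x) =
        -((‖x‖ : ℂ) ^ 2 * (inner ℂ x (T x) / (‖x‖ : ℂ) ^ 2 - z)) := by
      rw [sub_apply, inner_sub_right, Algebra.algebraMap_eq_smul_one, smul_apply, one_apply_eq_self,
        inner_smul_right, inner_self_eq_norm_sq_to_K]
      field_simp
      simp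
    rw [norm_inner_symm, this, norm_neg, norm_mul, norm_pow, Complex.norm_real, norm_norm]
  rw [heq]
  exact mul_le_mul_of_nonneg_left hdist (by positivity)

/-! ### Hyponormal operators -/

/-- An operator `T` is hyponormal if `T* T - T T* ≥ 0`, that is, if `‖T* x‖ ≤ ‖T x‖` for all `x`. -/
def IsHyponormal (T : E →L[ℂ] E) : Prop := ∀ x, ‖adjoint T x‖ ≤ ‖T x‖

/-- Expanding both squared norms yields equal cross terms and equal terms in `|a|²`. -/
theorem IsHyponormal.sub_smul_one {T : E →L[ℂ] E} (hT : IsHyponormal T) (a : ℂ) :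
    IsHyponormal (T - a • (1 : E →L[ℂ] E)) := by
  intro x
  have hadj : adjoint (T - a • (1 : E →L[ℂ] E)) x = adjoint T x - (starRingEnd ℂ) a • x := by
    rw [map_sub, map_smulₛₗ, ← star_eq_adjoint (1 : E →L[ℂ] E), star_one]
    rfl
  rw [hadj]
  change ‖_‖ ≤ ‖T x - a • x‖
  refine le_of_sq_le_sq ?_ (norm_nonneg _)
  rw [norm_sub_sq (𝕜 := ℂ), norm_sub_sq (𝕜 := ℂ), norm_smul, norm_smul, RCLike.norm_conj]
  have h2 : RCLike.re (inner ℂ (adjoint T x) ((starRingEnd ℂ) a • x)) =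
      RCLike.re (inner ℂ (T x) (a • x)) := by
    rw [inner_smul_right, inner_smul_right, adjoint_inner_left, ← inner_conj_symm x (T x),
      ← map_mul, RCLike.conj_re]
  rw [h2]
  have := pow_le_pow_left₀ (norm_nonneg _) (hT x) 2
  linarith

/-- Cauchy–Schwarz on `‖Tⁿ⁺¹x‖² = ⟨T*Tⁿ⁺¹x, Tⁿx⟩` and hyponormality give `‖Tⁿ⁺¹‖² ≤ ‖Tⁿ⁺²‖‖Tⁿ‖`,
which propagates the equality upwards. -/
theorem IsHyponormal.norm_pow {T : E →L[ℂ] E} (hT : IsHyponormal T) [Nontrivial E] (n : ℕ) :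
    ‖T ^ n‖ = ‖T‖ ^ n := by
  rcases eq_or_ne T 0 with rfl | hT0
  · rcases n with _ | n <;> simp
  have hpos : 0 < ‖T‖ := norm_pos_iff.mpr hT0
  have step : ∀ n, ‖T ^ (n + 1)‖ ^ 2 ≤ ‖T ^ (n + 2)‖ * ‖T ^ n‖ := by
    intro n
    have hb : ‖T ^ (n + 1)‖ ≤ √(‖T ^ (n + 2)‖ * ‖T ^ n‖) := by
      refine opNorm_le_bound _ (Real.sqrt_nonneg _) fun x => ?_
      rw [← Real.sqrt_sq (norm_nonneg x), ← Real.sqrt_mul (by positivity)]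
      refine Real.le_sqrt_of_sq_le ?_
      have e1 : (T ^ (n + 1)) x = T ((T ^ n) x) := by rw [pow_succ']; rfl
      have e2 : (T ^ (n + 2)) x = T ((T ^ (n + 1)) x) := by rw [pow_succ' T (n + 1)]; rfl
      calc ‖(T ^ (n + 1)) x‖ ^ 2 = ‖inner ℂ ((T ^ (n + 1)) x) ((T ^ (n + 1)) x)‖ := by
            rw [inner_self_eq_norm_sq_to_K, _root_.norm_pow, RCLike.norm_ofReal, abs_norm]
        _ = ‖inner ℂ (adjoint T ((T ^ (n + 1)) x)) ((T ^ n) x)‖ := by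
            rw [adjoint_inner_left, ← e1]
        _ ≤ ‖adjoint T ((T ^ (n + 1)) x)‖ * ‖(T ^ n) x‖ := norm_inner_le_norm _ _
        _ ≤ ‖(T ^ (n + 2)) x‖ * ‖(T ^ n) x‖ := by
            gcongr
            rw [e2]
            exact hT _
        _ ≤ (‖T ^ (n + 2)‖ * ‖x‖) * (‖T ^ n‖ * ‖x‖) := by
            gcongr <;> exact le_opNorm _ _
        _ = ‖T ^ (n + 2)‖ * ‖T ^ n‖ * ‖x‖ ^ 2 := by ring
    calc ‖T ^ (n + 1)‖ ^ 2 ≤ √(‖T ^ (n + 2)‖ * ‖T ^ n‖) ^ 2 := by gcongr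
      _ = _ := Real.sq_sqrt (by positivity)
  -- The inequality links three consecutive powers, so the induction carries two.
  have main : ∀ n, ‖T ^ n‖ = ‖T‖ ^ n ∧ ‖T ^ (n + 1)‖ = ‖T‖ ^ (n + 1) := by
    intro n
    induction n with
    | zero => simp
    | succ n ih =>
      refine ⟨ih.2, le_antisymm (norm_pow_le _ _) ?_⟩
      have := step n
      rw [ih.1, ih.2] at this
      refine le_of_mul_le_mul_right ?_ (pow_pos hpos n)
      calc _ = (‖T‖ ^ (n + 1)) ^ 2 := by ring
        _ ≤ _ := this
  exact (main n).1

theorem IsHyponormal.spectralRadius_eq {T : E →L[ℂ] E} (hT : IsHyponormal T) [Nontrivial E] :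
    spectralRadius ℂ T = ‖T‖₊ := by
  refine tendsto_nhds_unique (spectrum.pow_nnnorm_pow_one_div_tendsto_nhds_spectralRadius T) ?_
  refine tendsto_const_nhds.congr' ?_
  filter_upwards [Filter.eventually_ne_atTop 0] with n hn
  have h : ‖T ^ n‖₊ = ‖T‖₊ ^ n := NNReal.eq (hT.norm_pow n)
  rw [h, ENNReal.coe_pow, ← ENNReal.rpow_natCast, ← ENNReal.rpow_mul, mul_one_div_cancel
    (by exact_mod_cast hn), ENNReal.rpow_one]

theorem IsHyponormal.exists_mem_spectrum_norm_sub {T : E →L[ℂ] E} (hT : IsHyponormal T)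
    [Nontrivial E] (a : ℂ) :
    ∃ k ∈ spectrum ℂ T, ‖T - a • (1 : E →L[ℂ] E)‖ = ‖k - a‖ := by
  obtain ⟨k, hk, hkn⟩ := spectrum.exists_nnnorm_eq_spectralRadius (T - a • (1 : E →L[ℂ] E))
  rw [(hT.sub_smul_one a).spectralRadius_eq, ENNReal.coe_inj] at hkn
  refine ⟨k + a, ?_, ?_⟩
  · rw [← Algebra.algebraMap_eq_smul_one, ← spectrum.sub_singleton_eq] at hk
    obtain ⟨w, hw, v, rfl, rfl⟩ := hk
    simpa using hw
  · rw [add_sub_cancel_right]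
    exact congrArg NNReal.toReal hkn.symm

/-- A line separating `z` from the hull is replaced by a large circle: a disc with a remote centre
contains the spectrum, hence the numerical range, but not `z`. -/
theorem IsHyponormal.numericalRange_subset_convexHull_spectrum {T : E →L[ℂ] E}
    (hT : IsHyponormal T) [Nontrivial E] : numericalRange T ⊆ convexHull ℝ (spectrum ℂ T) := by
  rintro z ⟨x, hx, hTx⟩
  by_contra hz
  obtain ⟨f, u, hfu, huf⟩ := geometric_hahn_banach_closed_point (convex_convexHull ℝ _)
    (spectrum.isCompact T).convexHull_of_finiteDimensional.isClosed hz
  -- Makes `2n(f z - u)` exceed `‖T‖²`, a bound for `‖k‖²` over the spectrum.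
  obtain ⟨n, hn⟩ := exists_nat_gt (‖T‖ ^ 2 / (2 * (f z - u)))
  rw [div_lt_iff₀ (by linarith)] at hn
  have hf : ∀ w : ℂ, f w = f 1 * w.re + f Complex.I * w.im := by
    intro w
    conv_lhs => rw [← Complex.re_add_im w, mul_comm _ Complex.I]
    have e1 : ((w.re : ℝ) : ℂ) = w.re • (1 : ℂ) := by simp
    have e2 : Complex.I * ((w.im : ℝ) : ℂ) = w.im • Complex.I := by
      rw [Complex.real_smul, mul_comm]
    rw [e1, e2, map_add, map_smul, map_smul, smul_eq_mul, smul_eq_mul]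
    ring
  -- The centre is `-n` times the gradient of `f`, so that `‖w - a‖²` is `2n f w` up to `‖w‖²` and a
  -- constant.
  let a : ℂ := ⟨-(n * f 1), -(n * f Complex.I)⟩
  have hsq : ∀ w : ℂ, ‖w - a‖ ^ 2 = ‖w‖ ^ 2 + 2 * n * f w + ‖a‖ ^ 2 := by
    intro w
    rw [hf, Complex.sq_norm, Complex.sq_norm, Complex.sq_norm, Complex.normSq_apply,
      Complex.normSq_apply, Complex.normSq_apply]
    simp only [Complex.sub_re, Complex.sub_im, a]
    ring
  obtain ⟨k, hk, hkn⟩ := hT.exists_mem_spectrum_norm_sub a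
  have hza : ‖z - a‖ ≤ ‖k - a‖ := by
    have e : z - a = inner ℂ x ((T - a • (1 : E →L[ℂ] E)) x) := by
      simp [inner_self_eq_norm_sq_to_K, hx, hTx]
    rw [← hkn, e]
    refine (norm_inner_le_norm _ _).trans ?_
    simpa [hx] using le_opNorm (T - a • (1 : E →L[ℂ] E)) x
  have h1 := pow_le_pow_left₀ (norm_nonneg _) hza 2
  rw [hsq, hsq] at h1
  have h2 : ‖k‖ ^ 2 ≤ ‖T‖ ^ 2 :=
    pow_le_pow_left₀ (norm_nonneg _) (spectrum.norm_le_norm_of_mem hk) 2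
  have h3 : 2 * n * f k ≤ 2 * n * u :=
    mul_le_mul_of_nonneg_left (hfu k (subset_convexHull ℝ _ hk)).le (by positivity)
  nlinarith [sq_nonneg ‖z‖]

/-- The closure of the numerical range of a hyponormal operator is the convex hull of its
spectrum. -/
theorem IsHyponormal.closure_numericalRange_eq_convexHull_spectrum {T : E →L[ℂ] E}
    (hT : IsHyponormal T) [Nontrivial E] :
    closure (numericalRange T) = convexHull ℝ (spectrum ℂ T) :=
  (closure_minimal hT.numericalRange_subset_convexHull_spectrum
    (spectrum.isCompact T).convexHull_of_finiteDimensional.isClosed).antisymm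
    (convexHull_min (spectrum_subset_closure_numericalRange T) (convex_numericalRange T).closure)

end ContinuousLinearMap

/-! ### Restriction to the closure of the range of `B = A^{1/2}` -/

namespace SemiHilbert

open ContinuousLinearMap

variable {H : Type*} [NormedAddCommGroup H] [InnerProductSpace ℂ H]

/-- The closure of the range of `B`. -/
abbrev closedRange (B : H →L[ℂ] H) : Submodule ℂ H := B.range.topologicalClosure

theorem apply_mem_closedRange (B : H →L[ℂ] H) (x : H) : B x ∈ closedRange B :=
  B.range.le_topologicalClosure ⟨x, rfl⟩

theorem closedRange_induction {B : H →L[ℂ] H} {p : H → Prop} (hp : IsClosed {y | p y})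
    (h : ∀ x, p (B x)) {y : H} (hy : y ∈ closedRange B) : p y :=
  closure_minimal (t := {y | p y}) (by rintro _ ⟨x, rfl⟩; exact h x) hp hy

theorem apply_mem_closedRange_of_forall {B T : H →L[ℂ] H} (h : ∀ x, T (B x) ∈ closedRange B)
    {y : H} (hy : y ∈ closedRange B) : T y ∈ closedRange B :=
  closedRange_induction (p := fun y => T y ∈ closedRange B)
    (B.range.isClosed_topologicalClosure.preimage T.continuous) h hy

/-- The restriction to `closedRange B` of an operator that maps the range of `B` into
`closedRange B`. -/
noncomputable def restrictClosedRange {B : H →L[ℂ] H} (T : H →L[ℂ] H)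
    (h : ∀ x, T (B x) ∈ closedRange B) : closedRange B →L[ℂ] closedRange B :=
  (T ∘L (closedRange B).subtypeL).codRestrict (closedRange B)
    fun y => apply_mem_closedRange_of_forall h y.2

theorem apply_apply_mem_closedRange_of_commute {B T : H →L[ℂ] H} (h : Commute T B) (x : H) :
    T (B x) ∈ closedRange B := by
  have : T (B x) = B (T x) := DFunLike.congr_fun h.eq x
  rw [this]
  exact apply_mem_closedRange B _

theorem restrictClosedRange_ext {B : H →L[ℂ] H} {F G : closedRange B →L[ℂ] closedRange B}
    (h : ∀ x, F ⟨B x, apply_mem_closedRange B x⟩ = G ⟨B x, apply_mem_closedRange B x⟩) :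
    F = G := by
  ext ⟨y, hy⟩
  have key : ∀ hy : y ∈ closedRange B, F ⟨y, hy⟩ = G ⟨y, hy⟩ := by
    have hd : Dense (Set.range fun x => (⟨B x, apply_mem_closedRange B x⟩ : closedRange B)) := by
      intro z
      rw [closure_subtype]
      have himg : (Subtype.val '' Set.range fun x =>
          (⟨B x, apply_mem_closedRange B x⟩ : closedRange B)) = Set.range B := by
        rw [← Set.range_comp]
        rfl
      rw [himg]
      exact z.2
    intro hy
    refine congrFun (Continuous.ext_on hd F.continuous G.continuous ?_) _
    rintro _ ⟨x, rfl⟩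
    exact h x
  rw [key hy]

variable [CompleteSpace H]

theorem commute_adjoint_of_isSelfAdjoint {B T : H →L[ℂ] H} (hB : IsSelfAdjoint B)
    (h : Commute T B) : Commute (adjoint T) B := by
  have := h.star_star
  rwa [hB.star_eq] at this

theorem adjoint_restrictClosedRange {B T : H →L[ℂ] H} (h : ∀ x, T (B x) ∈ closedRange B)
    (h' : ∀ x, adjoint T (B x) ∈ closedRange B) :
    adjoint (restrictClosedRange T h) = restrictClosedRange (adjoint T) h' := by
  refine ((eq_adjoint_iff _ _).mpr fun x y => ?_).symm
  exact adjoint_inner_left T (y : H) (x : H)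

theorem innerA_mul_self {B T : H →L[ℂ] H} (hB : IsSelfAdjoint B) (hTB : Commute T B) (x : H) :
    innerA (B * B) (T x) x = inner ℂ (B x) (T (B x)) := by
  have h : T (B x) = B (T x) := DFunLike.congr_fun hTB.eq x
  rw [h]
  exact (hB.isSymmetric x (B (T x))).symm

theorem normA_mul_self {B : H →L[ℂ] H} (hB : IsSelfAdjoint B) (x : H) :
    normA (B * B) x = ‖B x‖ := by
  have h : innerA (B * B) x x = inner ℂ (B x) (B x) := (hB.isSymmetric x (B x)).symm
  rw [normA, h, inner_self_eq_norm_sq_to_K]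
  have h2 : (((‖B x‖ : ℝ) : ℂ) ^ 2).re = ‖B x‖ ^ 2 := by
    rw [← Complex.ofReal_pow, Complex.ofReal_re]
  exact (congrArg Real.sqrt h2).trans (Real.sqrt_sq (norm_nonneg _))

theorem closure_numericalRangeA_mul_self {B T : H →L[ℂ] H} (hB : IsSelfAdjoint B)
    (hTB : Commute T B) :
    closure (numericalRangeA (B * B) T) = closure (numericalRange
      (restrictClosedRange T (apply_apply_mem_closedRange_of_commute hTB))) := by
  refine (closure_mono ?_).antisymm (closure_minimal ?_ isClosed_closure)
  · rintro z ⟨x, hx, rfl⟩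
    rw [normA_mul_self hB] at hx
    rw [innerA_mul_self hB hTB]
    exact ⟨⟨B x, apply_mem_closedRange B x⟩, hx, rfl⟩
  · rintro z ⟨⟨y, hy⟩, hy1, rfl⟩
    have hy1' : ‖y‖ = 1 := hy1
    change inner ℂ y (T y) ∈ _
    have hy0 : y ≠ 0 := by
      rintro rfl
      simp at hy1'
    have hyn : (‖y‖ : ℂ) ^ 2 ≠ 0 := by simp [hy1']
    -- Nonzero vectors of the range can be normalised, and the Rayleigh quotient is continuous at
    -- `y`.
    have hmem : y ∈ closure (Set.range B ∩ {0}ᶜ) := by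
      have := isOpen_compl_singleton.inter_closure (s := {(0 : H)}ᶜ) (t := Set.range B) ⟨hy0, hy⟩
      rwa [Set.inter_comm] at this
    have hc : ContinuousAt (fun v : H => inner ℂ v (T v) / (‖v‖ : ℂ) ^ 2) y := by
      refine ContinuousAt.div ?_ ?_ hyn
      · exact (continuous_id.inner T.continuous).continuousAt
      · exact ((Complex.continuous_ofReal.comp continuous_norm).pow 2).continuousAt
    have h := hc.continuousWithinAt.mem_closure_image hmem
    have e : inner ℂ y (T y) / (‖y‖ : ℂ) ^ 2 = inner ℂ y (T y) := by simp [hy1']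
    rw [← e]
    refine closure_mono ?_ h
    rintro _ ⟨_, ⟨⟨x, rfl⟩, hx0⟩, rfl⟩
    have hx0' : (‖B x‖ : ℂ) ≠ 0 := by simpa using hx0
    refine ⟨(‖B x‖ : ℂ)⁻¹ • x, ?_, ?_⟩
    · rw [normA_mul_self hB, map_smul, norm_smul, norm_inv, Complex.norm_real, norm_norm,
        inv_mul_cancel₀ (norm_ne_zero_iff.mpr hx0)]
    · rw [innerA_mul_self hB hTB, map_smul, map_smul, inner_smul_left, inner_smul_right, map_inv₀,
        Complex.conj_ofReal]
      field_simp

/-- As `T*B² = B²T^♯` and `T` commutes with `B`, the form of `A(T^♯T - TT^♯)` at `x` is `‖TBx‖² -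
‖T*Bx‖²`; density of the range does the rest. -/
theorem isHyponormal_restrictClosedRange {B T : H →L[ℂ] H} (hB : IsSelfAdjoint B)
    (hpos : (B * B).IsPositive) (hT : T ∈ BA (B * B)) (hyp : IsAHyponormal (B * B) T)
    (hTB : Commute T B) :
    IsHyponormal (restrictClosedRange T (apply_apply_mem_closedRange_of_commute hTB)) := by
  have hTB' := commute_adjoint_of_isSelfAdjoint hB hTB
  have hsym : ∀ x y : H, inner ℂ (B x) y = inner ℂ x (B y) := hB.isSymmetric
  have hTBx : ∀ x, T (B x) = B (T x) := DFunLike.congr_fun hTB.eq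
  have hTBx' : ∀ x, adjoint T (B x) = B (adjoint T x) := DFunLike.congr_fun hTB'.eq
  have hV : ∀ x, adjoint T (B (B x)) = B (B (sharp (B * B) T x)) :=
    DFunLike.congr_fun (isReducedAdjoint_sharp hpos hT).1
  have hle : ∀ x, ‖adjoint T (B x)‖ ≤ ‖T (B x)‖ := by
    intro x
    have h := (Complex.le_def.mp (hyp.inner_nonneg_right x)).1
    have e1 : inner ℂ x (B (B (sharp (B * B) T (T x)))) = inner ℂ (T (B x)) (T (B x)) := by
      rw [← hV, adjoint_inner_right, hTBx, hsym]
    have e2 : inner ℂ x (B (B (T (sharp (B * B) T x)))) =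
        inner ℂ (adjoint T (B x)) (adjoint T (B x)) := by
      rw [← hTBx, ← hTBx, ← hV, ← adjoint_inner_left, hTBx' (B x), hTBx', hsym]
    have e3 : inner ℂ x (((B * B) ∘L (sharp (B * B) T * T - T * sharp (B * B) T)) x) =
        inner ℂ (T (B x)) (T (B x)) - inner ℂ (adjoint T (B x)) (adjoint T (B x)) := by
      rw [← e1, ← e2, ← inner_sub_right, ← map_sub, ← map_sub]
      rfl
    rw [e3, inner_self_eq_norm_sq_to_K, inner_self_eq_norm_sq_to_K] at h
    refine le_of_sq_le_sq ?_ (norm_nonneg _)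
    have h' : (0 : ℝ) ≤ ‖T (B x)‖ ^ 2 - ‖adjoint T (B x)‖ ^ 2 := by
      have e4 : ((((‖T (B x)‖ : ℝ) : ℂ) ^ 2 - ((‖adjoint T (B x)‖ : ℝ) : ℂ) ^ 2)).re =
          ‖T (B x)‖ ^ 2 - ‖adjoint T (B x)‖ ^ 2 := by
        rw [← Complex.ofReal_pow, ← Complex.ofReal_pow, ← Complex.ofReal_sub, Complex.ofReal_re]
      rw [← e4]
      exact h
    linarith
  intro y
  rw [adjoint_restrictClosedRange _ (apply_apply_mem_closedRange_of_commute hTB')]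
  exact closedRange_induction (p := fun y => ‖adjoint T y‖ ≤ ‖T y‖)
    (isClosed_le (by fun_prop) (by fun_prop)) hle y.2

/-! ### The `A`-spectrum as an ordinary spectrum -/

theorem eq_zero_of_mul_self_apply {B : H →L[ℂ] H} (hB : IsSelfAdjoint B) {x : H}
    (h : B (B x) = 0) : B x = 0 := by
  have hs : inner ℂ (B x) (B x) = inner ℂ x (B (B x)) := hB.isSymmetric x (B x)
  rwa [h, inner_zero_right, inner_self_eq_zero] at hs

theorem mem_BA_of_commute {B T : H →L[ℂ] H} (hB : IsSelfAdjoint B) (h : Commute T B) :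
    T ∈ BA B := by
  rintro _ ⟨x, rfl⟩
  exact ⟨adjoint T x,
    (DFunLike.congr_fun (commute_adjoint_of_isSelfAdjoint hB h).eq x).symm⟩

/-- The `A`-inverse `S` need not commute with `B` or preserve the closed range. The inverse on that
space is induced instead by the adjoint `Y` of the reduced adjoint of `S` relative to `B`, which
satisfies `YB = BS`. -/
theorem isUnit_restrictClosedRange_of_mul_eq {B L S : H →L[ℂ] H} (hB : B.IsPositive)
    (hLB : Commute L B) (hS : S ∈ BA B) (h1 : B * B * L * S = B * B)
    (h2 : B * B * S * L = B * B) :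
    IsUnit (restrictClosedRange L (apply_apply_mem_closedRange_of_commute hLB)) := by
  have hLBx : ∀ x, L (B x) = B (L x) := DFunLike.congr_fun hLB.eq
  have hV := (isReducedAdjoint_sharp hB hS).1
  have hY : ∀ x, adjoint (sharp B S) (B x) = B (S x) := by
    have := congrArg adjoint hV
    rw [adjoint_comp, adjoint_comp, adjoint_adjoint, hB.isSelfAdjoint.adjoint_eq] at this
    exact fun x => (DFunLike.congr_fun this x).symm
  have key : ∀ R : H →L[ℂ] H, B * B * R = B * B → ∀ x, B (R x) = B x := by
    intro R hR x
    have h0 : B (B (R x - x)) = 0 := by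
      rw [map_sub, map_sub, sub_eq_zero]
      exact DFunLike.congr_fun hR x
    have := eq_zero_of_mul_self_apply hB.isSelfAdjoint h0
    rwa [map_sub, sub_eq_zero] at this
  have k1 : ∀ x, B (L (S x)) = B x := key (L * S) (by rw [← mul_assoc, h1])
  have k2 : ∀ x, B (S (L x)) = B x := key (S * L) (by rw [← mul_assoc, h2])
  have hYmem : ∀ x, adjoint (sharp B S) (B x) ∈ closedRange B := by
    intro x
    rw [hY]
    exact apply_mem_closedRange B _
  refine isUnit_iff_exists.mpr ⟨restrictClosedRange _ hYmem, ?_, ?_⟩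
  · refine restrictClosedRange_ext fun x => Subtype.ext ?_
    change L (adjoint (sharp B S) (B x)) = B x
    rw [hY, hLBx, k1]
  · refine restrictClosedRange_ext fun x => Subtype.ext ?_
    change adjoint (sharp B S) (L (B x)) = B x
    rw [hLBx, hY, k2]

theorem exists_of_isUnit_restrictClosedRange {B L : H →L[ℂ] H} (hB : IsSelfAdjoint B)
    (hB0 : B ≠ 0) (hLB : Commute L B)
    (hu : IsUnit (restrictClosedRange L (apply_apply_mem_closedRange_of_commute hLB))) :
    ∃ S ∈ BA B, S ≠ 0 ∧ B * B * L * S = B * B ∧ B * B * S * L = B * B := by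
  have hLBx : ∀ x, L (B x) = B (L x) := DFunLike.congr_fun hLB.eq
  have : CompleteSpace (closedRange B) :=
    B.range.isClosed_topologicalClosure.completeSpace_coe
  obtain ⟨G, hLG, hGL⟩ := isUnit_iff_exists.mp hu
  have hLG' : ∀ y : closedRange B, L (G y) = y := fun y =>
    congrArg Subtype.val (DFunLike.congr_fun hLG y)
  -- The inverse on the closed range, extended by zero on its orthogonal complement.
  let S : H →L[ℂ] H := (closedRange B).subtypeL ∘L G ∘L (closedRange B).orthogonalProjectionOnto
  have hBP : ∀ x, B ((closedRange B).orthogonalProjectionOnto x) = B x := by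
    intro x
    refine (sub_eq_zero.mp ?_).symm
    rw [← map_sub, ← inner_self_eq_zero (𝕜 := ℂ)]
    exact (hB.isSymmetric _ _).symm.trans ((Submodule.mem_orthogonal _ _).mp
      ((closedRange B).sub_starProjection_mem_orthogonal x) _ (apply_mem_closedRange B _))
  have hSy : ∀ y : closedRange B, S y = G y := fun y =>
    congrArg (fun v => (G v : H)) (Submodule.orthogonalProjectionOnto_mem_subspace_eq_self y)
  have hSL : ∀ y : closedRange B, S (L y) = y := fun y =>
    (hSy (restrictClosedRange L (apply_apply_mem_closedRange_of_commute hLB) y)).trans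
      (congrArg Subtype.val (DFunLike.congr_fun hGL y))
  have h1 : ∀ x, B (L (S x)) = B x := fun x => by
    rw [← hBP x]
    exact congrArg B (hLG' _)
  -- `Bx = BLSx = L(BSx)`, and `S` undoes `L` on the closed range.
  have hSB : ∀ x, S (B x) = B (S x) := fun x => by
    rw [← h1 x, ← hLBx]
    exact hSL ⟨B (S x), apply_mem_closedRange B _⟩
  have h2 : ∀ x, B (S (L x)) = B x := fun x => by
    rw [← hSB, ← hLBx]
    exact hSL ⟨B x, apply_mem_closedRange B x⟩
  refine ⟨S, mem_BA_of_commute hB (ContinuousLinearMap.ext hSB), ?_, ?_, ?_⟩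
  · intro hS0
    refine hB0 (ContinuousLinearMap.ext fun x => ?_)
    rw [← h1, hS0]
    simp
  · exact ContinuousLinearMap.ext fun x => congrArg B (h1 x)
  · exact ContinuousLinearMap.ext fun x => congrArg B (h2 x)

theorem spectrumA_mul_self {B T : H →L[ℂ] H} (hB : B.IsPositive) (hB0 : B ≠ 0)
    (hsqrt : CFC.sqrt (B * B) = B) (hTB : Commute T B) :
    spectrumA (B * B) T = spectrum ℂ
      (restrictClosedRange T (apply_apply_mem_closedRange_of_commute hTB)) := by
  refine congrArg compl (Set.ext fun z => ?_)
  have hLB : Commute (z • (1 : H →L[ℂ] H) - T) B :=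
    ((Commute.one_left B).smul_left z).sub_left hTB
  have hres : algebraMap ℂ _ z -
      restrictClosedRange T (apply_apply_mem_closedRange_of_commute hTB) =
      restrictClosedRange _ (apply_apply_mem_closedRange_of_commute hLB) := by
    rw [Algebra.algebraMap_eq_smul_one]
    rfl
  have hhalf : BAhalf (B * B) = BA B := by
    rw [BAhalf, hsqrt, BA]
  change IsAInvertible _ _ ↔ IsUnit _
  rw [hres, IsAInvertible, hhalf]
  constructor
  · rintro ⟨-, -, S, hS, -, h1, h2⟩
    exact isUnit_restrictClosedRange_of_mul_eq hB hLB hS h1 h2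
  · intro hu
    obtain ⟨S, hS, hS0, h1, h2⟩ := exists_of_isUnit_restrictClosedRange hB.isSelfAdjoint hB0 hLB hu
    refine ⟨mem_BA_of_commute hB.isSelfAdjoint hLB, ?_, S, hS, hS0, h1, h2⟩
    -- The condition `L ≠ 0` is automatic: otherwise `B² = B²LS = 0`, which forces `B = 0`.
    intro hL0
    rw [hL0, mul_zero, zero_mul] at h1
    refine hB0 (ContinuousLinearMap.ext fun x => ?_)
    exact eq_zero_of_mul_self_apply hB.isSelfAdjoint (DFunLike.congr_fun h1 x).symm

end SemiHilbert

theorem mainTheorem2 {H : Type*} [NormedAddCommGroup H] [InnerProductSpace ℂ H] [CompleteSpace H]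
    (A : H →L[ℂ] H) (hA : A.IsPositive) (hA0 : A ≠ 0)
    (T : H →L[ℂ] H) (hT : T ∈ SemiHilbert.BA A) (hyp : SemiHilbert.IsAHyponormal A T)
    (hcomm : Commute T A) :
    closure (SemiHilbert.numericalRangeA A T) = convexHull ℝ (SemiHilbert.spectrumA A T) := by
  have hA' : 0 ≤ A := (ContinuousLinearMap.nonneg_iff_isPositive A).mpr hA
  obtain ⟨B, hBdef⟩ : ∃ B : H →L[ℂ] H, B = CFC.sqrt A := ⟨_, rfl⟩
  have hB : B.IsPositive :=
    (ContinuousLinearMap.nonneg_iff_isPositive B).mp (hBdef ▸ CFC.sqrt_nonneg A)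
  have hTB : Commute T B := by
    rw [hBdef]
    -- The square root comes from the functional calculus of `A`, so it commutes with whatever
    -- commutes with `A`.
    exact (hcomm.symm.cfcₙ_nnreal NNReal.sqrt).symm
  obtain rfl : A = B * B := by rw [hBdef, CFC.sqrt_mul_sqrt_self A hA']
  have hB0 : B ≠ 0 := by
    rintro rfl
    simp at hA0
  have : CompleteSpace (SemiHilbert.closedRange B) :=
    B.range.isClosed_topologicalClosure.completeSpace_coe
  have : Nontrivial (SemiHilbert.closedRange B) := by
    obtain ⟨x, hx⟩ := DFunLike.ne_iff.mp hB0
    exact ⟨⟨B x, SemiHilbert.apply_mem_closedRange B x⟩, 0, fun h => hx (congrArg Subtype.val h)⟩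
  rw [SemiHilbert.closure_numericalRangeA_mul_self hB.isSelfAdjoint hTB,
    SemiHilbert.spectrumA_mul_self hB hB0 hBdef.symm hTB]
  exact (SemiHilbert.isHyponormal_restrictClosedRange hB.isSelfAdjoint hA hT hyp
    hTB).closure_numericalRange_eq_convexHull_spectrum
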